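/- Let $(R,\mathfrak m)$ be a complete noetherian normal local domain of dimension $d\ge 2$ and let $\mathfrak a\subset R$ be an ideal of height $d-1$. Let $X=\operatorname{Spec}(R)\setminus\{\mathfrak m\}$ be the punctured spectrum, let $Y=V(\mathfrak a)\setminus\{\mathfrak m\}$, and let $(\widehat X,\mathcal O_{\widehat X})$ be the formal completion of $X$ along $Y$, i.e. the space $Y$ with the sheaf of rings $\varprojlim_n \mathcal O_X/\mathcal I^n$, where $\mathcal I$ is the ideal sheaf on $X$ associated with $\mathfrak a$. One says that $Y$ is $G_2$ in $X$ if the canonical map $H^0(X,\mathcal O_X)\to H^0(\widehat X,\mathcal O_{\widehat X})$ is an isomorphism. Then $Y$ is not $G_2$ in $X$. Moreover, the canonical map $R\to H^0(X,\mathcal O_X)$ is an isomorphism, while $H^0(\widehat X,\mathcal O_{\widehat X})$ is not a finitely generated $R$-module. -/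

import Mathlib

open CategoryTheory AlgebraicGeometry TopologicalSpace Opposite

universe u

namespace FormalCompletion

section general

variable {X : Scheme.{u}} (I : X.IdealSheafData)

/-- The `n`-th infinitesimal neighbourhood of `V(I)` in `X`: the closed subscheme of `X`
with structure sheaf `𝒪_X / I ^ (n + 1)`. -/
noncomputable abbrev nbhd (n : ℕ) : Scheme.{u} := (I ^ (n + 1)).subscheme

/-- The closed immersion of the `n`-th infinitesimal neighbourhood into `X`. -/
noncomputable abbrev nbhdι (n : ℕ) : nbhd I n ⟶ X := (I ^ (n + 1)).subschemeι

lemma pow_succ_le (n : ℕ) : I ^ (n + 1 + 1) ≤ I ^ (n + 1) := by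
  intro U
  exact Ideal.pow_le_pow_right (Nat.le_succ _)

/-- The closed immersion of the `n`-th infinitesimal neighbourhood into the next one. -/
noncomputable def transition (n : ℕ) : nbhd I n ⟶ nbhd I (n + 1) :=
  Scheme.IdealSheafData.inclusion (pow_succ_le I n)

lemma transition_ι (n : ℕ) : transition I n ≫ nbhdι I (n + 1) = nbhdι I n :=
  Scheme.IdealSheafData.inclusion_subschemeι _

/-- The closed subset `Y = V(I)` of `X`, the underlying space of the formal completion. -/
abbrev space : TopCat.{u} := TopCat.of (I.support : Set X)

lemma nbhdι_mem (n : ℕ) (y : nbhd I n) : nbhdι I n y ∈ (I.support : Set X) := by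
  have h : nbhdι I n y ∈ Set.range (nbhdι I n) := ⟨y, rfl⟩
  rw [Scheme.IdealSheafData.range_subschemeι] at h
  exact h

/-- The identification of the underlying space of the `n`-th infinitesimal neighbourhood
with `Y` (as a continuous map). -/
noncomputable def toSpace (n : ℕ) : (nbhd I n).carrier ⟶ space I :=
  TopCat.ofHom ⟨fun y ↦ ⟨nbhdι I n y, nbhdι_mem I n y⟩,
    (nbhdι I n).continuous.subtype_mk _⟩

/-- The open subset `V` of `Y` regarded as an open subset of the `n`-th infinitesimal
neighbourhood. -/
noncomputable abbrev pull (n : ℕ) (V : Opens (space I)) : (nbhd I n).Opens :=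
  (Opens.map (toSpace I n)).obj V

lemma pull_le (n : ℕ) (V : Opens (space I)) :
    pull I n V ≤ transition I n ⁻¹ᵁ pull I (n + 1) V := by
  intro y hy
  have h : nbhdι I (n + 1) (transition I n y) = nbhdι I n y := by
    rw [← transition_ι I n]; rfl
  change (⟨nbhdι I (n + 1) (transition I n y), _⟩ : space I) ∈ V
  have hy' : (⟨nbhdι I n y, nbhdι_mem I n y⟩ : space I) ∈ V := hy
  convert hy' using 2

/-- The transition map `𝒪_X / I ^ (n + 2) → 𝒪_X / I ^ (n + 1)` on sections over `V`. -/
noncomputable def transitionMap (n : ℕ) (V : Opens (space I)) :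
    Γ(nbhd I (n + 1), pull I (n + 1) V) ⟶ Γ(nbhd I n, pull I n V) :=
  (transition I n).appLE (pull I (n + 1) V) (pull I n V) (pull_le I n V)

/-- The sections over `V` of `lim_n 𝒪_X / I ^ (n + 1)`: compatible families of sections. -/
noncomputable def sections (V : Opens (space I)) :
    Subring (∀ n : ℕ, Γ(nbhd I n, pull I n V)) where
  carrier := {s | ∀ n, (transitionMap I n V).hom (s (n + 1)) = s n}
  mul_mem' ha hb n := by simp [ha n, hb n]
  one_mem' n := by simp
  add_mem' ha hb n := by simp [ha n, hb n]
  zero_mem' n := by simp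
  neg_mem' ha n := by simp [ha n]

/-- Restriction of sections of the `n`-th infinitesimal neighbourhood. -/
noncomputable abbrev res (n : ℕ) {V W : Opens (space I)} (h : V ≤ W) :
    Γ(nbhd I n, pull I n W) ⟶ Γ(nbhd I n, pull I n V) :=
  (nbhd I n).presheaf.map ((Opens.map (toSpace I n)).map (homOfLE h)).op

lemma res_transition (n : ℕ) {V W : Opens (space I)} (h : V ≤ W) :
    res I (n + 1) h ≫ transitionMap I n V = transitionMap I n W ≫ res I n h := by
  simp only [transitionMap, Scheme.Hom.appLE_map, Scheme.Hom.map_appLE]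

lemma res_transition_apply (n : ℕ) {V W : Opens (space I)} (h : V ≤ W)
    (s : Γ(nbhd I (n + 1), pull I (n + 1) W)) :
    (transitionMap I n V).hom ((res I (n + 1) h).hom s) =
      (res I n h).hom ((transitionMap I n W).hom s) :=
  congr($(res_transition I n h).hom s)

/-- Restriction of sections of `lim_n 𝒪_X / I ^ (n + 1)`. -/
noncomputable def sectionsRes {V W : Opens (space I)} (h : V ≤ W) :
    sections I W →+* sections I V where
  toFun s := ⟨fun n ↦ (res I n h).hom (s.1 n), fun n ↦ by
    rw [res_transition_apply, s.2 n]⟩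
  map_one' := by ext n; simp
  map_mul' a b := by ext n; simp
  map_zero' := by ext n; simp
  map_add' a b := by ext n; simp

/-- The presheaf `lim_n 𝒪_X / I ^ (n + 1)` on `Y`. -/
noncomputable def presheaf : (space I).Presheaf CommRingCat.{u} where
  obj V := CommRingCat.of (sections I V.unop)
  map f := CommRingCat.ofHom (sectionsRes I f.unop.le)
  map_id V := by
    refine CommRingCat.hom_ext (RingHom.ext fun s ↦ Subtype.ext (funext fun n ↦ ?_))
    change (res I n _).hom (s.1 n) = s.1 n
    have : res I n (le_refl V.unop) = 𝟙 _ := (nbhd I n).presheaf.map_id _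
    exact congr($(this).hom (s.1 n))
  map_comp {U V W} f g := by
    refine CommRingCat.hom_ext (RingHom.ext fun s ↦ Subtype.ext (funext fun n ↦ ?_))
    have : res I n (g.unop.le.trans f.unop.le) = res I n f.unop.le ≫ res I n g.unop.le := by
      rw [← Functor.map_comp]; rfl
    exact congr($(this).hom (s.1 n))

lemma pull_iSup (n : ℕ) {ι : Type*} (V : ι → Opens (space I)) :
    pull I n (iSup V) ≤ ⨆ i, pull I n (V i) := by
  intro y hy
  have hy' : toSpace I n y ∈ iSup V := hy
  obtain ⟨i, hi⟩ := Opens.mem_iSup.mp hy'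
  exact Opens.mem_iSup.mpr ⟨i, hi⟩

lemma presheaf_isSheaf : (presheaf I).IsSheaf := by
  rw [TopCat.Presheaf.isSheaf_iff_isSheafUniqueGluing]
  intro ι V sf hsf
  have key (n : ℕ) : ∃! t : Γ(nbhd I n, pull I n (iSup V)),
      ∀ i, (res I n (le_iSup V i)).hom t = (sf i).1 n := by
    refine (nbhd I n).sheaf.existsUnique_gluing' (fun i ↦ pull I n (V i)) (pull I n (iSup V))
      (fun i ↦ (Opens.map (toSpace I n)).map (homOfLE (le_iSup V i))) (pull_iSup I n V)
      (fun i ↦ (sf i).1 n) ?_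
    intro i j
    exact congr(($(hsf i j)).1 n)
  choose t ht ht' using key
  have hsep (n : ℕ) (a b : Γ(nbhd I n, pull I n (iSup V)))
      (hab : ∀ i, (res I n (le_iSup V i)).hom a = (res I n (le_iSup V i)).hom b) : a = b :=
    (nbhd I n).sheaf.eq_of_locally_eq' (fun i ↦ pull I n (V i)) (pull I n (iSup V))
      (fun i ↦ (Opens.map (toSpace I n)).map (homOfLE (le_iSup V i))) (pull_iSup I n V) a b hab
  have hcomp : ∀ n, (transitionMap I n (iSup V)).hom (t (n + 1)) = t n := by
    intro n
    refine hsep n _ _ fun i ↦ ?_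
    rw [← res_transition_apply, ht, ht]
    exact (sf i).2 n
  refine ⟨⟨t, hcomp⟩, fun i ↦ Subtype.ext (funext fun n ↦ ht n i), fun s hs ↦ ?_⟩
  refine Subtype.ext (funext fun n ↦ ht' n _ fun i ↦ ?_)
  exact congr(($(hs i)).1 n)

end general

end FormalCompletion

open FormalCompletion in
/-- The formal completion of the scheme `X` along the closed subset `Y = V(I)`: the space `Y`
with the sheaf of rings `lim_n 𝒪_X / I ^ n`. -/
noncomputable def formalCompletion {X : Scheme.{u}} (I : X.IdealSheafData) :
    SheafedSpace CommRingCat.{u} where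
  carrier := space I
  presheaf := presheaf I
  IsSheaf := presheaf_isSheaf I

namespace FormalCompletion

variable {X : Scheme.{u}} (I : X.IdealSheafData)

/-- The inclusion of `Y` into `X`. -/
noncomputable def inclusion : space I ⟶ (X.carrier : TopCat.{u}) :=
  TopCat.ofHom ⟨Subtype.val, continuous_subtype_val⟩

lemma pull_inclusion_le (n : ℕ) (U : X.Opens) :
    pull I n ((Opens.map (inclusion I)).obj U) ≤ nbhdι I n ⁻¹ᵁ U :=
  le_refl (nbhdι I n ⁻¹ᵁ U)

/-- Restriction of sections of `𝒪_X` to the `n`-th infinitesimal neighbourhood. -/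
noncomputable def toNbhd (n : ℕ) (U : X.Opens) :
    Γ(X, U) ⟶ Γ(nbhd I n, pull I n ((Opens.map (inclusion I)).obj U)) :=
  (nbhdι I n).appLE U _ (pull_inclusion_le I n U)

lemma toNbhd_transition (n : ℕ) (U : X.Opens) :
    toNbhd I (n + 1) U ≫ transitionMap I n _ = toNbhd I n U := by
  have h := Scheme.Hom.appLE_comp_appLE (transition I n) (nbhdι I (n + 1)) U
    (pull I (n + 1) ((Opens.map (inclusion I)).obj U))
    (pull I n ((Opens.map (inclusion I)).obj U)) (pull_inclusion_le I (n + 1) U)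
    (pull_le I n _)
  simp only [transition_ι] at h
  exact h

/-- The family of restrictions of a section of `𝒪_X` to all infinitesimal neighbourhoods. -/
noncomputable def toSections (U : X.Opens) :
    Γ(X, U) →+* sections I ((Opens.map (inclusion I)).obj U) :=
  RingHom.codRestrict (RingHom.pi fun n ↦ (toNbhd I n U).hom) (sections I _) fun s n ↦
    congr($(toNbhd_transition I n U).hom s)

end FormalCompletion

open FormalCompletion in
/-- The canonical morphism of ringed spaces from the formal completion to `X`. -/
noncomputable def formalCompletionι {X : Scheme.{u}} (I : X.IdealSheafData) :
    formalCompletion I ⟶ X.toSheafedSpace :=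
  InducedCategory.homMk
    { base := inclusion I
      c :=
        { app := fun U ↦ CommRingCat.ofHom (toSections I U.unop)
          naturality := fun U V f ↦ by
            refine CommRingCat.hom_ext (RingHom.ext fun s ↦ Subtype.ext (funext fun n ↦ ?_))
            have h : X.presheaf.map f ≫ toNbhd I n V.unop = toNbhd I n U.unop ≫
                res I n ((Opens.map (inclusion I)).map f.unop).le := by
              rw [toNbhd, toNbhd, Scheme.Hom.map_appLE, Scheme.Hom.appLE_map]
            exact congr($(h).hom s) } }

/-- The closed subset `Y = V(I)` is `G₂` in the scheme `X`: the canonical map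
`H⁰(X, 𝒪_X) → H⁰(X̂, 𝒪_X̂)` to the ring of global sections of the formal completion `X̂` of `X`
along `Y` is an isomorphism. (On a noetherian scheme this depends only on `Y`.) -/
def IsG2 {X : Scheme.{u}} (I : X.IdealSheafData) : Prop :=
  IsIso ((formalCompletionι I).hom.c.app (op ⊤))

section local_ring

variable (R : Type u) [CommRing R]

/-- The spectrum of a local ring with its closed point removed, as an open subset. -/
noncomputable def puncturedSpecOpen [IsLocalRing R] : (Spec (CommRingCat.of R)).Opens :=
  ⟨{IsLocalRing.closedPoint R}ᶜ, (IsLocalRing.isClosed_singleton_closedPoint R).isOpen_compl⟩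

/-- The punctured spectrum `X = Spec R \ {𝔪}` of a local ring, as a scheme. -/
noncomputable abbrev puncturedSpec [IsLocalRing R] : Scheme.{u} := (puncturedSpecOpen R).toScheme

/-- The canonical ring homomorphism `R → H⁰(X, 𝒪_X)` for `X` the punctured spectrum. -/
noncomputable def toPuncturedSections [IsLocalRing R] :
    CommRingCat.of R ⟶ Γ(puncturedSpec R, ⊤) :=
  (Scheme.ΓSpecIso (CommRingCat.of R)).inv ≫ (puncturedSpecOpen R).ι.appTop

/-- The ideal sheaf on `Spec R` associated with an ideal of `R`. -/
noncomputable def idealSheaf {R : Type u} [CommRing R] (a : Ideal R) :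
    (Spec (CommRingCat.of R)).IdealSheafData :=
  Scheme.IdealSheafData.ofIdealTop (a.map (Scheme.ΓSpecIso (CommRingCat.of R)).inv.hom)

/-- The restriction to the punctured spectrum of the ideal sheaf associated with an ideal `𝔞`;
its support is `Y = V(𝔞) \ {𝔪}`. -/
noncomputable def puncturedIdealSheaf {R : Type u} [CommRing R] [IsLocalRing R] (a : Ideal R) :
    (puncturedSpec R).IdealSheafData :=
  (idealSheaf a).comap (puncturedSpecOpen R).ι

lemma mem_support_puncturedIdealSheaf {R : Type u} [CommRing R] [IsLocalRing R] (a : Ideal R)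
    (p : puncturedSpec R) :
    p ∈ (puncturedIdealSheaf a).support ↔ a ≤ ((puncturedSpecOpen R).ι p).asIdeal := by
  have h1 : p ∈ (puncturedIdealSheaf a).support ↔
      (puncturedSpecOpen R).ι p ∈ ((idealSheaf a).support : Set (Spec (CommRingCat.of R))) := by
    rw [puncturedIdealSheaf, Scheme.IdealSheafData.support_comap]
    rfl
  rw [h1, idealSheaf, Scheme.IdealSheafData.coe_support_ofIdealTop, Ideal.map,
    Scheme.zeroLocus_span, Scheme.mem_zeroLocus_iff]
  simp only [Set.mem_image, forall_exists_index, and_imp, forall_apply_eq_imp_iff₂]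
  refine forall₂_congr fun r _ ↦ ?_
  rw [basicOpen_eq_of_affine]
  exact not_not

end local_ring

/-! Write S for the global sections of the formal completion. Since the height of 𝔞 is d - 1, the
nonmaximal primes over 𝔞 are minimal over it, hence finite in number, and prime avoidance yields x ∈
𝔪 outside all of them (`IsLocalRing.exists_mem_maximalIdeal_forall_notMem`). So x vanishes nowhere
on Y and becomes a unit in S (`isUnit_toSections`). If S were finite over R, then S = 𝔪S would force
S = 0 by Nakayama; but Y is nonempty, so S ≠ 0. Normality and d ≥ 2 give R = H⁰(X, 𝒪_X)
(`toPuncturedSections_bijective`), so G₂ would make R → S surjective, hence finite. -/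

/-! ### Commutative algebra of local rings -/

/-- In a normal noetherian local domain of dimension at least two, a fraction `b / c` that is
multiplied into the ring by the maximal ideal lies in the ring. -/
lemma IsLocalRing.dvd_of_forall_mem_maximalIdeal_dvd_mul {R : Type*} [CommRing R] [IsDomain R]
    [IsLocalRing R] [IsNoetherianRing R] [IsIntegrallyClosed R]
    (hR : 1 < (IsLocalRing.maximalIdeal R).height) {b c : R} (hc : c ≠ 0)
    (h : ∀ y ∈ IsLocalRing.maximalIdeal R, c ∣ y * b) : c ∣ b := by
  set m := IsLocalRing.maximalIdeal R
  choose! g hg using h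
  -- Here `g` is multiplication by b / c on 𝔪. If it preserves 𝔪, then b / c is integral by the
  -- determinant trick. Otherwise it sends some y to a unit, so 𝔪 = (y), against Krull's height
  -- theorem.
  by_cases hgm : ∀ y ∈ m, g y ∈ m
  · let K := FractionRing R
    have hcK : algebraMap R K c ≠ 0 := by simpa using hc
    let x : K := algebraMap R K b / algebraMap R K c
    have hx (y : R) (hy : y ∈ m) : x * algebraMap R K y = algebraMap R K (g y) := by
      have := congrArg (algebraMap R K) (hg y hy)
      simp only [map_mul] at this
      rw [div_mul_eq_mul_div, div_eq_iff hcK]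
      linear_combination this
    let N : Submodule R K := Submodule.map (Algebra.linearMap R K) m
    have hN : N ≠ ⊥ := by
      intro hN
      have hm : m = ⊥ := by
        rw [eq_bot_iff]
        intro y hy
        have : Algebra.linearMap R K y ∈ N := Submodule.mem_map_of_mem hy
        rw [hN] at this
        simpa using this
      rw [hm] at hR
      simp at hR
    have hint : IsIntegral R x := by
      refine isIntegral_of_smul_mem_submodule (M := K) N hN
        ((IsNoetherian.noetherian m).map _) x ?_
      rintro _ ⟨y, hy, rfl⟩
      exact ⟨g y, hgm y hy, (hx y hy).symm⟩
    obtain ⟨r, hr⟩ := IsIntegrallyClosed.isIntegral_iff.mp hint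
    refine ⟨r, IsFractionRing.injective R K ?_⟩
    rw [map_mul, hr, mul_div_cancel₀ _ hcK]
  · push Not at hgm
    obtain ⟨y, hy, hgy⟩ := hgm
    have hu : IsUnit (g y) := by simpa [m] using hgy
    obtain ⟨v, hv⟩ := hu.exists_left_inv
    have hmy : m ≤ Ideal.span {y} := by
      intro z hz
      refine Ideal.mem_span_singleton'.mpr ⟨v * g z, mul_left_cancel₀ hc ?_⟩
      have h1 := hg y hy
      have h2 := hg z hz
      linear_combination (-v * y) * h2 + (v * z) * h1 + c * z * hv
    exact absurd ((Ideal.height_mono hmy).trans (Ideal.height_span_singleton_le_one hy)) hR.not_ge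

/-- Elements of an overring that are multiplied into a normal local domain of dimension at
least two by a power of the maximal ideal already lie in it. -/
lemma IsLocalRing.mem_range_of_forall_pow_mul_mem_range {R S : Type*} [CommRing R] [IsDomain R]
    [IsLocalRing R] [IsNoetherianRing R] [IsIntegrallyClosed R] [CommRing S] [IsDomain S]
    (hR : 1 < (IsLocalRing.maximalIdeal R).height) (φ : R →+* S) (hφ : Function.Injective φ)
    (n : ℕ) (s : S) (h : ∀ y ∈ IsLocalRing.maximalIdeal R ^ n, φ y * s ∈ φ.range) :
    s ∈ φ.range := by
  induction n generalizing s with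
  | zero => simpa using h 1 (by simp)
  | succ n ih =>
    refine ih s fun y hy ↦ ?_
    -- Any nonzero c ∈ 𝔪 is a denominator for φ y * s: this element is b / c, and 𝔪 multiplies it
    -- into R.
    obtain ⟨c, hcm, hc⟩ : ∃ c ∈ IsLocalRing.maximalIdeal R, c ≠ 0 := by
      refine Submodule.exists_mem_ne_zero_of_ne_bot fun hm ↦ ?_
      rw [hm] at hR
      simp at hR
    have key (z) (hz : z ∈ IsLocalRing.maximalIdeal R) : ∃ r, φ r = φ z * (φ y * s) := by
      obtain ⟨r, hr⟩ := h (y * z) (by rw [pow_succ]; exact Ideal.mul_mem_mul hy hz)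
      exact ⟨r, by rw [hr, map_mul]; ring⟩
    obtain ⟨b, hb⟩ := key c hcm
    obtain ⟨r, hr⟩ := IsLocalRing.dvd_of_forall_mem_maximalIdeal_dvd_mul hR hc (b := b) <| by
      intro z hz
      obtain ⟨r, hr⟩ := key z hz
      refine ⟨r, hφ ?_⟩
      rw [map_mul, map_mul, hb, hr]
      ring
    refine ⟨r, mul_left_cancel₀ ((map_ne_zero_iff φ hφ).mpr hc) ?_⟩
    rw [← hb, hr, map_mul]

/-- The primes containing an ideal of height one less than the dimension, other than the maximal
ideal, are avoided by some element of the maximal ideal. -/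
lemma IsLocalRing.exists_mem_maximalIdeal_forall_notMem {R : Type*} [CommRing R]
    [IsLocalRing R] [IsNoetherianRing R] (a : Ideal R)
    (ha : (IsLocalRing.maximalIdeal R).height ≤ a.height + 1) :
    ∃ x ∈ IsLocalRing.maximalIdeal R, ∀ p : Ideal R, p.IsPrime → a ≤ p →
      p ≠ IsLocalRing.maximalIdeal R → x ∉ p := by
  have hmin (p : Ideal R) (hp : p.IsPrime) (hap : a ≤ p) (hpm : p ≠ IsLocalRing.maximalIdeal R) :
      p ∈ a.minimalPrimes := by
    obtain ⟨q, hq, hqp⟩ := Ideal.exists_minimalPrimes_le hap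
    have := hq.isPrime
    obtain rfl | hlt := hqp.eq_or_lt
    · exact hq
    -- A chain q < p < 𝔪 above 𝔞 would give ht 𝔪 ≥ ht 𝔞 + 2.
    have h1 := Ideal.height_strict_mono_of_isPrime_of_isPrime hlt
    have h2 := Ideal.height_strict_mono_of_isPrime_of_isPrime
      ((IsLocalRing.le_maximalIdeal hp.ne_top).lt_of_ne hpm)
    have h3 := Ideal.height_mono hq.le
    have h4 := (Order.add_one_le_of_lt (h3.trans_lt h1)).trans_lt h2
    exact absurd ha h4.not_ge
  have hfin : {p : Ideal R | p ∈ a.minimalPrimes ∧ p ≠ IsLocalRing.maximalIdeal R}.Finite :=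
    (Ideal.finite_minimalPrimes_of_isNoetherianRing R a).subset fun _ h ↦ h.1
  by_contra! hx
  -- The arguments `⊤ ⊤` are the two indices at which primality may fail; here every member is
  -- prime, so the choice is immaterial.
  obtain ⟨p, ⟨hp, hpm⟩, hmp⟩ := (Ideal.subset_union_prime_finite hfin (f := id)
    (I := IsLocalRing.maximalIdeal R) ⊤ ⊤ fun p hp _ _ ↦ hp.1.isPrime).mp <| by
      intro x hxm
      obtain ⟨p, hp, hap, hpm, hxp⟩ := hx x hxm
      exact Set.mem_biUnion (show p ∈ {p : Ideal R | _} from ⟨hmin p hp hap hpm, hpm⟩) hxp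
  exact hpm (le_antisymm (IsLocalRing.le_maximalIdeal hp.isPrime.ne_top) hmp)

/-- An ideal of height smaller than the dimension is contained in a nonmaximal prime. -/
lemma IsLocalRing.exists_isPrime_le_ne_maximalIdeal {R : Type*} [CommRing R]
    [IsLocalRing R] (a : Ideal R) (ha : a.height < (IsLocalRing.maximalIdeal R).height) :
    ∃ p : Ideal R, p.IsPrime ∧ a ≤ p ∧ p ≠ IsLocalRing.maximalIdeal R := by
  by_contra! h
  refine ha.not_ge ?_
  rw [Ideal.height_eq_inf_minimalPrimes a]
  refine le_iInf₂ fun p hp ↦ ?_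
  rw [h p hp.isPrime hp.le]

/-- A nonzero finite algebra over a local ring admits no unit coming from the maximal ideal. -/
lemma RingHom.Finite.not_isUnit_map_of_mem_maximalIdeal {R S : Type*} [CommRing R]
    [IsLocalRing R] [CommRing S] [Nontrivial S] {φ : R →+* S} (hφ : φ.Finite) {x : R}
    (hx : x ∈ IsLocalRing.maximalIdeal R) : ¬ IsUnit (φ x) := by
  intro hu
  algebraize [φ]
  -- Nakayama: s = x • (x⁻¹ s) shows S = 𝔪S.
  have h : (⊤ : Submodule R S) = ⊥ := by
    refine Submodule.eq_bot_of_le_smul_of_le_jacobson_bot (IsLocalRing.maximalIdeal R) ⊤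
      Module.Finite.fg_top (fun s _ ↦ ?_) (IsLocalRing.jacobson_eq_maximalIdeal ⊥ bot_ne_top).ge
    obtain ⟨v, hv⟩ := hu.exists_right_inv
    have : s = x • (v * s) := by
      rw [Algebra.smul_def, ← mul_assoc]
      exact (by rw [hv, one_mul] : s = φ x * v * s)
    rw [this]
    exact Submodule.smul_mem_smul hx trivial
  exact one_ne_zero ((Submodule.mem_bot R).mp (h ▸ trivial : (1 : S) ∈ (⊥ : Submodule R S)))

/-! ### Units and nontriviality of sections of the formal completion -/

namespace FormalCompletion

variable {X : Scheme.{u}} (I : X.IdealSheafData)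

/-- Inverses are unique, so those chosen level by level are compatible with the transition maps. -/
lemma isUnit_sections {V : Opens (space I)} (s : sections I V) (h : ∀ n, IsUnit (s.1 n)) :
    IsUnit s := by
  choose t ht using fun n ↦ (h n).exists_right_inv
  refine IsUnit.of_mul_eq_one (⟨t, fun n ↦ (h n).mul_left_cancel ?_⟩ : sections I V)
    (Subtype.ext (funext ht))
  rw [ht n, ← s.2 n, ← map_mul, ht (n + 1), map_one]

/-- A function on `X` which does not vanish on `V(I)` is invertible on the formal completion. -/
lemma isUnit_toSections {U : X.Opens} (f : Γ(X, U))
    (hf : ∀ y ∈ U, y ∈ I.support → y ∈ X.basicOpen f) : IsUnit (toSections I U f) := by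
  refine isUnit_sections I _ fun n ↦ ?_
  change IsUnit ((nbhdι I n).appLE U _ (pull_inclusion_le I n U) f)
  refine RingedSpace.isUnit_of_isUnit_germ _ _ _ fun y hy ↦ ?_
  refine ((nbhd I n).mem_basicOpen _ y hy).mp ?_
  rw [Scheme.basicOpen_appLE]
  exact ⟨hy, hf _ (pull_inclusion_le I n U hy) (nbhdι_mem I n y)⟩

/-- Already 1 ≠ 0 at level 0, whose points are those of V(I). -/
lemma nontrivial_sections {V : Opens (space I)} (hV : (V : Set (space I)).Nonempty) :
    Nontrivial (sections I V) := by
  obtain ⟨⟨y, hy⟩, hyV⟩ := hV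
  have hy' : y ∈ Set.range (nbhdι I 0) := by
    rw [Scheme.IdealSheafData.range_subschemeι]
    simpa using hy
  obtain ⟨z, rfl⟩ := hy'
  have : Nonempty (pull I 0 V) := ⟨⟨z, hyV⟩⟩
  have : Nontrivial Γ(nbhd I 0, pull I 0 V) := inferInstance
  refine ⟨1, 0, fun h ↦ ?_⟩
  exact one_ne_zero (congrFun (congrArg Subtype.val h) 0 :
    (1 : Γ(nbhd I 0, pull I 0 V)) = 0)

end FormalCompletion

/-! ### Functions on the punctured spectrum -/

section local_ring

variable (R : Type u) [CommRing R] [IsLocalRing R]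

lemma basicOpen_le_puncturedSpecOpen {f : R} (hf : f ∈ IsLocalRing.maximalIdeal R) :
    PrimeSpectrum.basicOpen f ≤ puncturedSpecOpen R := by
  rintro p hp rfl
  exact hp hf

lemma mem_basicOpen_toPuncturedSections (f : R) (p : puncturedSpec R) :
    p ∈ (puncturedSpec R).basicOpen ((toPuncturedSections R).hom f) ↔
      f ∉ ((puncturedSpecOpen R).ι p).asIdeal := by
  have h : (toPuncturedSections R).hom f = (puncturedSpecOpen R).ι.appTop
      ((Scheme.ΓSpecIso (CommRingCat.of R)).inv f) := rfl
  rw [h, ← Scheme.preimage_basicOpen_top, basicOpen_eq_of_affine]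
  rfl

end local_ring
section local_ring

variable (R : Type u) [CommRing R] [IsLocalRing R]

/-- D(f) lies in the punctured spectrum and has ring of sections R_f, where the denominator of s can
be cleared. The resulting identity lifts because restriction to a nonempty open of an integral
scheme is injective. -/
lemma exists_pow_mul_mem_range_toPuncturedSections [IsDomain R] {f : R}
    (hf : f ∈ IsLocalRing.maximalIdeal R) (hf0 : f ≠ 0) (s : Γ(puncturedSpec R, ⊤)) :
    ∃ n : ℕ, (toPuncturedSections R).hom (f ^ n) * s ∈ (toPuncturedSections R).hom.range := by
  let A := CommRingCat.of R
  let W : (Spec A).Opens := (puncturedSpecOpen R).ι ''ᵁ ⊤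
  have hW : PrimeSpectrum.basicOpen f ≤ W :=
    (basicOpen_le_puncturedSpecOpen R hf).trans (puncturedSpecOpen R).ι_image_top.ge
  have : Nonempty (PrimeSpectrum.basicOpen f) := ⟨⟨⟨⊥, Ideal.isPrime_bot⟩, by simpa using hf0⟩⟩
  let g : Γ(Spec A, ⊤) := (Scheme.ΓSpecIso A).inv f
  let D : (Spec A).Opens := (Spec A).basicOpen g
  have hD : D = PrimeSpectrum.basicOpen f := basicOpen_eq_of_affine (R := A) f
  have hDW : D ≤ W := hD.trans_le hW
  have : Nonempty D := hD ▸ this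
  have : IsDomain A := inferInstanceAs (IsDomain R)
  have hinj := map_injective_of_isIntegral (Spec A) (homOfLE hDW)
  have hloc : IsLocalization.Away g Γ(Spec A, D) :=
    (isAffineOpen_top (Spec A)).isLocalization_basicOpen g
  let s' : Γ(Spec A, W) := s
  obtain ⟨⟨t, ⟨_, n, rfl⟩⟩, ht⟩ := IsLocalization.surj (Submonoid.powers g)
    ((Spec A).presheaf.map (homOfLE hDW).op s')
  let ρ : Γ(Spec A, ⊤) ⟶ Γ(Spec A, W) := (Spec A).presheaf.map (homOfLE le_top).op
  have hρ (r : Γ(Spec A, ⊤)) : algebraMap Γ(Spec A, ⊤) Γ(Spec A, D) r =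
      (Spec A).presheaf.map (homOfLE hDW).op (ρ r) := by
    rw [← CommRingCat.comp_apply, ← Functor.map_comp]
    rfl
  have key : ρ g ^ n * s' = ρ t := by
    apply hinj
    rw [map_mul, map_pow, ← hρ, ← hρ, mul_comm, ← map_pow]
    exact ht
  refine ⟨n, (Scheme.ΓSpecIso A).hom t, ?_⟩
  have h1 (r : R) : (toPuncturedSections R).hom r = ρ ((Scheme.ΓSpecIso A).inv r) := rfl
  rw [map_pow, h1, h1]
  refine Eq.trans ?_ key.symm
  congr 1
  exact congr($((Scheme.ΓSpecIso A).hom_inv_id) t)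

lemma toPuncturedSections_injective [IsDomain R] (hR : 0 < (IsLocalRing.maximalIdeal R).height) :
    Function.Injective (toPuncturedSections R).hom := by
  let A := CommRingCat.of R
  have : IsDomain A := inferInstanceAs (IsDomain R)
  -- Positive height keeps the generic point distinct from the closed point.
  have : Nonempty ((puncturedSpecOpen R).ι ''ᵁ ⊤ : (Spec A).Opens) := by
    refine ⟨⟨⟨⊥, Ideal.isPrime_bot⟩, ?_⟩⟩
    rw [Scheme.Opens.ι_image_top]
    intro h
    have hbot : (⊥ : Ideal R) = IsLocalRing.maximalIdeal R := congrArg PrimeSpectrum.asIdeal h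
    rw [← hbot] at hR
    simp at hR
  exact (map_injective_of_isIntegral (Spec A)
    (homOfLE (le_top : (puncturedSpecOpen R).ι ''ᵁ ⊤ ≤ ⊤))).comp
    (ConcreteCategory.bijective_of_isIso (Scheme.ΓSpecIso A).inv).injective

/-- Functions on the punctured spectrum of a normal noetherian local domain of dimension at least
two extend over the closed point. -/
lemma toPuncturedSections_bijective [IsDomain R] [IsNoetherianRing R] [IsIntegrallyClosed R]
    (hR : 1 < (IsLocalRing.maximalIdeal R).height) :
    Function.Bijective (toPuncturedSections R).hom := by
  have hinj := toPuncturedSections_injective R (zero_le_one.trans_lt hR)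
  refine ⟨hinj, fun s ↦ ?_⟩
  let A := CommRingCat.of R
  have : IsDomain A := inferInstanceAs (IsDomain R)
  have : Nonempty (puncturedSpec R) := by
    obtain ⟨p, hp, -, hpm⟩ := IsLocalRing.exists_isPrime_le_ne_maximalIdeal (⊥ : Ideal R)
      (by simpa using zero_le_one.trans_lt hR)
    exact ⟨⟨⟨p, hp⟩, fun h ↦ hpm (congrArg PrimeSpectrum.asIdeal h)⟩⟩
  have : IsIntegral (puncturedSpec R) := inferInstance
  have : IsDomain Γ(puncturedSpec R, ⊤) := inferInstance
  let φ := (toPuncturedSections R).hom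
  -- The ideal of denominators of s. Its radical contains 𝔪, so it contains a power of 𝔪.
  let J : Ideal R :=
    { carrier := {r | φ r * s ∈ φ.range}
      zero_mem' := ⟨0, by simp⟩
      add_mem' := fun {x y} hx hy ↦ by
        have : φ x * s + φ y * s ∈ φ.range := add_mem (show φ x * s ∈ φ.range from hx) hy
        rwa [← add_mul, ← map_add] at this
      smul_mem' := fun r x hx ↦ by
        have : φ r * (φ x * s) ∈ φ.range := mul_mem ⟨r, rfl⟩ hx
        rwa [← mul_assoc, ← map_mul] at this }
  have hJ : IsLocalRing.maximalIdeal R ≤ J.radical := fun f hf ↦ by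
    by_cases hf0 : f = 0
    · exact hf0 ▸ zero_mem _
    · exact exists_pow_mul_mem_range_toPuncturedSections R hf hf0 s
  obtain ⟨n, hn⟩ := Ideal.exists_pow_le_of_le_radical_of_fg hJ (IsNoetherian.noetherian _)
  exact IsLocalRing.mem_range_of_forall_pow_mul_mem_range hR φ hinj n s fun y hy ↦ hn hy

end local_ring

/-! ### The main theorem -/

theorem corollary4p2 (R : Type u) [CommRing R] [IsDomain R] [IsLocalRing R] [IsNoetherianRing R]
    [IsAdicComplete (IsLocalRing.maximalIdeal R) R] [IsIntegrallyClosed R]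
    (d : ℕ) (hd : 2 ≤ d) (hdim : ringKrullDim R = d)
    (a : Ideal R) (ha : a.height = ((d - 1 : ℕ) : ℕ∞)) :
    ¬ IsG2 (puncturedIdealSheaf a) ∧
    Function.Bijective (toPuncturedSections R).hom ∧
    ¬ (toPuncturedSections R ≫
        (formalCompletionι (puncturedIdealSheaf a)).hom.c.app (op ⊤)).hom.Finite := by
  have hm : (IsLocalRing.maximalIdeal R).height = d := by
    have := IsLocalRing.maximalIdeal_height_eq_ringKrullDim (R := R)
    rw [hdim] at this
    exact_mod_cast this
  have hbij : Function.Bijective (toPuncturedSections R).hom :=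
    toPuncturedSections_bijective R (by rw [hm]; exact_mod_cast hd)
  have hfin : ¬ (toPuncturedSections R ≫
      (formalCompletionι (puncturedIdealSheaf a)).hom.c.app (op ⊤)).hom.Finite := by
    intro hfin
    obtain ⟨p, hp, hap, hpm⟩ := IsLocalRing.exists_isPrime_le_ne_maximalIdeal a
      (by rw [hm, ha]; exact_mod_cast (by omega : d - 1 < d))
    obtain ⟨x, hxm, hx⟩ := IsLocalRing.exists_mem_maximalIdeal_forall_notMem a
      (by rw [hm, ha]; exact_mod_cast (by omega : d ≤ d - 1 + 1))
    -- A point of Y, which makes the ring of formal sections nonzero.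
    let y : puncturedSpec R := ⟨⟨p, hp⟩, fun h ↦ hpm (congrArg PrimeSpectrum.asIdeal h)⟩
    have hy : y ∈ (puncturedIdealSheaf a).support :=
      (mem_support_puncturedIdealSheaf a y).mpr hap
    have := FormalCompletion.nontrivial_sections (puncturedIdealSheaf a)
      (V := (Opens.map (FormalCompletion.inclusion _)).obj ⊤) ⟨⟨y, hy⟩, trivial⟩
    refine RingHom.Finite.not_isUnit_map_of_mem_maximalIdeal
      (S := FormalCompletion.sections (puncturedIdealSheaf a)
        ((Opens.map (FormalCompletion.inclusion _)).obj ⊤)) hfin hxm ?_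
    refine FormalCompletion.isUnit_toSections (puncturedIdealSheaf a)
      ((toPuncturedSections R).hom x) fun z _ hz ↦ ?_
    rw [mem_basicOpen_toPuncturedSections]
    exact hx _ ((puncturedSpecOpen R).ι z).isPrime
      ((mem_support_puncturedIdealSheaf a z).mp hz)
      fun h ↦ z.2 (PrimeSpectrum.ext h)
  refine ⟨fun hG ↦ hfin ?_, hbij, hfin⟩
  have : IsIso ((formalCompletionι (puncturedIdealSheaf a)).hom.c.app (op ⊤)) := hG
  refine RingHom.Finite.of_surjective _ ?_
  rw [CommRingCat.hom_comp, RingHom.coe_comp]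
  exact (ConcreteCategory.bijective_of_isIso _).surjective.comp hbij.surjective
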